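/- **Theorem (Minimum bearing-constrained path length).** For $r>0$ and $0<\theta_c<2\pi$, the *left turn-to-bearing path* with radius $r$ and final bearing $\theta_c$ is the curve in the plane, parametrized by arc length $d\ge 0$, that starts at the origin with orientation $0$ (along the positive $x$-axis), follows a circular arc and then the tangent line: $$H(d)=\begin{cases}\bigl(r\sin\tfrac dr,\; r-r\cos\tfrac dr\bigr), & d\le r\theta_c,\\ \bigl((d-r\theta_c)\cos\theta_c+r\sin\theta_c,\;(d-r\theta_c)\sin\theta_c-r\cos\theta_c+r\bigr), & d>r\theta_c.\end{cases}$$ Let $0<r_\alpha$ and $0<\theta_\alpha$, and let $r_\beta,\theta_\beta$ be real. Let $\mathcal D(x,y)$ be the set of all path lengths $D>0$ such that the path with some radius $r\in[r_\alpha,r_\beta]$ and some final bearing $\theta_c\in[\theta_\alpha,\theta_\beta]$, $0<\theta_c<2\pi$, satisfies $H(D)=(x,y)$. The point $(x,y)$ is *reachable* if $\mathcal D(x,y)\neq\emptyset$. Put $\theta_m=2\,\mathrm{atan}_2(y,x)$ (with $\mathrm{atan}_2\in(-\pi,\pi]$), $r_m=\dfrac{x^2+y^2}{2y}$ for $y\ne0$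 (and $r_m=0$ for $y=0$), $$R(x,y,\theta)=\frac{x\sin\theta-y\cos\theta}{1-\cos\theta},\qquad L(x,y,\theta,r)=r\theta+\bigl\lVert(x,y)-r(\sin\theta,1-\cos\theta)\bigr\rVert,$$ and, for $r>0$, $$\Theta(x,y,r)=\begin{cases}2\arctan\!\left(\dfrac{x-\sqrt{x^2-(2r-y)y}}{2r-y}\right)+P(x,y,r), & 2r\ne y,\\ 2\arctan\frac{y}{2x}, & 2r=y,\ x>0,\\ \pi, & 2r=y,\ x\le0,\end{cases}$$ where $P(x,y,r)=0$ if $(x>0\wedge y>0)\vee(x\le0\wedge 2r<y)$, $P(x,y,r)=2\pi$ if $(x\ge0\wedge y<0)\vee(x<0\wedge y<2r)$, and (by convention; these points play no role) $P(x,y,r)=0$ otherwise, and the square root of a negative number is read as $0$. If $(x,y)$ is reachable, then $\mathcal D(x,y)$ has a least element, and it equals $$d_{\min}(x,y)=\begin{cases} L(x,y,\Theta(x,y,r_\alpha),r_\alpha), & \theta_\alpha\le\Theta(x,y,r_\alpha)\le\theta_\beta,\\[2pt] L(x,y,\theta_\alpha,R(x,y,\theta_\alpha)), & x^2+y^2>2r_\alpha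 y\ \wedge\ \Theta(x,y,r_\alpha)<\theta_\alpha\ \wedge\\ & \bigl[\bigl(0\le y\wedge(r_\alpha\le r_m\vee y=0)\wedge\theta_\alpha<\theta_m\bigr)\vee\bigl(y<0\wedge\theta_m<0\bigr)\bigr],\\[2pt] L(x,y,\theta_m,r_m), & r_\alpha\le r_m\le r_\beta\ \wedge\ \theta_m\le\max(\theta_\alpha,\Theta(x,y,r_\alpha)). \end{cases}$$ For every reachable point at least one of the three conditions holds, and $d_{\min}(x,y)$ equals the stated expression for each condition that holds (overlapping pieces agree). -/

import Mathlib

noncomputable section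

namespace TurnToBearing

/-- `x`-coordinate, after travelled distance `d`, of the turn-to-bearing motion that starts at the
origin with orientation `0`, follows a circular arc of radius `r` until its bearing is `θc`, and
then continues along the tangent line. -/
def Hx (r θc d : ℝ) : ℝ :=
  if d ≤ r * θc then r * Real.sin (d / r)
  else (d - r * θc) * Real.cos θc + r * Real.sin θc

/-- `y`-coordinate, after travelled distance `d`, of the same motion. -/
def Hy (r θc d : ℝ) : ℝ :=
  if d ≤ r * θc then -(r * Real.cos (d / r)) + r
  else (d - r * θc) * Real.sin θc - r * Real.cos θc + r

/-- `PathSegment D fx fy p q`: the planar curve `d ↦ (fx d, fy d)`, `0 ≤ d`, is continuous,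
differentiable, parametrized by arc length, starts at `p`, and is at `q` after path length `D`. -/
structure PathSegment (D : ℝ) (fx fy : ℝ → ℝ) (p q : ℝ × ℝ) : Prop where
  continuous_fst : ContinuousOn fx (Set.Ici 0)
  continuous_snd : ContinuousOn fy (Set.Ici 0)
  differentiable_fst : ∀ d, 0 < d → DifferentiableAt ℝ fx d
  differentiable_snd : ∀ d, 0 < d → DifferentiableAt ℝ fy d
  integrable_speed : ∀ d, 0 ≤ d →
    IntervalIntegrable (fun a => Real.sqrt (deriv fx a ^ 2 + deriv fy a ^ 2))
      MeasureTheory.volume 0 d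
  arcLength : ∀ d, 0 ≤ d → ∫ a in (0 : ℝ)..d, Real.sqrt (deriv fx a ^ 2 + deriv fy a ^ 2) = d
  start : (fx 0, fy 0) = p
  finish : (fx D, fy D) = q

/-- The lengths `D > 0` of all turn-to-bearing paths from the origin (with initial orientation `0`)
to `(x, y)` whose radius is in `[rα, rβ]` and whose final bearing is in `[θα, θβ]`; as for every
turn-to-bearing path, `0 < r * θc < 2 * π * |r|`. -/
def pathLengths (rα rβ θα θβ x y : ℝ) : Set ℝ :=
  {D | 0 < D ∧ ∃ r ∈ Set.Icc rα rβ, ∃ θc ∈ Set.Icc θα θβ,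
    (0 < r * θc ∧ r * θc < 2 * Real.pi * |r|) ∧
    PathSegment D (Hx r θc) (Hy r θc) (0, 0) (x, y)}

/-- `(x, y)` is reachable: some admissible turn-to-bearing path leads to it. -/
def Reachable (rα rβ θα θβ x y : ℝ) : Prop :=
  (pathLengths rα rβ θα θβ x y).Nonempty

/-- Two-argument arctangent, with values in `(-π, π]`. -/
def atan2 (y x : ℝ) : ℝ := Complex.arg ⟨x, y⟩

/-- Bearing, at its end point `(x, y)`, of the circular arc from the origin to `(x, y)`. -/
def θm (x y : ℝ) : ℝ := 2 * atan2 y x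

/-- Radius of the circular arc from the origin to `(x, y)`; only meaningful for `y ≠ 0`
(and equal to `0` for `y = 0`). -/
def rm (x y : ℝ) : ℝ := (x ^ 2 + y ^ 2) / (2 * y)

/-- Radius for which `(x, y)` is approached with bearing `θ`. -/
def R (x y θ : ℝ) : ℝ := (x * Real.sin θ - y * Real.cos θ) / (1 - Real.cos θ)

open Classical in
/-- Phase correction in the approach angle, for left turns (`0 < r`). Points in neither region are
not reached by a turn of radius `r`, or have `y = 2 * r`. -/
def P (x y r : ℝ) : ℝ :=
  if (0 < x ∧ 0 < y) ∨ (x ≤ 0 ∧ 2 * r < y) then 0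
  else if (0 ≤ x ∧ y < 0) ∨ (x < 0 ∧ y < 2 * r) then 2 * Real.pi
  else 0

open Classical in
/-- Bearing with which `(x, y)` is approached by a left turn of radius `r > 0`. -/
def Θ (x y r : ℝ) : ℝ :=
  if 2 * r - y ≠ 0 then
    2 * Real.arctan ((x - Real.sqrt (x ^ 2 - (2 * r - y) * y)) / (2 * r - y)) + P x y r
  else if 0 < x then 2 * Real.arctan (y / (2 * x))
  else Real.pi

/-- Length of the path to `(x, y)` that turns with radius `r` to bearing `θ` and goes straight from
there. -/
def L (x y θ r : ℝ) : ℝ :=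
  r * θ + ‖!₂[x - r * Real.sin θ, y - r * (1 - Real.cos θ)]‖

/-- Condition of the first piece (minimum radius, induced bearing). -/
def MinRadiusCase (rα θα θβ x y : ℝ) : Prop :=
  θα ≤ Θ x y rα ∧ Θ x y rα ≤ θβ

/-- Condition of the second piece (minimum bearing, induced radius). -/
def MinBearingCase (rα θα x y : ℝ) : Prop :=
  x ^ 2 + y ^ 2 > 2 * rα * y ∧
  ((0 ≤ y ∧ (rα ≤ rm x y ∨ y = 0) ∧ θα < θm x y) ∨ (y < 0 ∧ θm x y < 0)) ∧
  Θ x y rα < θα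

/-- Condition of the third piece (pure circular arc). -/
def ArcCase (rα rβ θα x y : ℝ) : Prop :=
  rα ≤ rm x y ∧ rm x y ≤ rβ ∧ θm x y ≤ max θα (Θ x y rα)

open Classical in
/-- The three-piece minimum length function; the value `0` is used where no piece applies. -/
def dMin (rα rβ θα θβ x y : ℝ) : ℝ :=
  if MinRadiusCase rα θα θβ x y then L x y (Θ x y rα) rα
  else if MinBearingCase rα θα x y then L x y θα (R x y θα)
  else if ArcCase rα rβ θα x y then L x y (θm x y) (rm x y)
  else 0

end TurnToBearing

end

noncomputable section

namespace TurnToBearing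

open Real Set

/-! ### The motion is parametrized by arc length -/

/-! Fix the target point. Prescribing the bearing `τ` on arrival makes the end-point equations
linear in the radius and the straight length, with unique solution `R x y τ`, `S x y τ`. The length
thus becomes a function `F` of `τ` alone (`mem_pathLengths_iff`). Both `R' = S / (1 - cos)` and `F'
= R' * (τ - sin τ)` have the sign of `S`, and `S ≥ 0` holds between any two bearings where it holds
at both ends. So `R` and `F` increase along admissible bearings, and the shortest path is the one
with the smallest admissible bearing (`isLeast_of_passes`). Two lower bounds compete: `R ≥ rα`
forces `τ ≥ Θ x y rα` (`Θ_spec`), and the final bearing must be at least `θα`, unless the point is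
met on the arc, where `τ = θm x y`. The three pieces record which of the three angles is smallest
admissible. -/

theorem hasDerivAt_ite_le {f g : ℝ → ℝ} {a f' : ℝ} (hf : HasDerivAt f f' a)
    (hg : HasDerivAt g f' a) (h : f a = g a) :
    HasDerivAt (fun d => if d ≤ a then f d else g d) f' a := by
  have h1 : HasDerivWithinAt (fun d => if d ≤ a then f d else g d) f' (Iic a) a :=
    hf.hasDerivWithinAt.congr (fun d hd => if_pos hd) (if_pos le_rfl)
  have h2 : HasDerivWithinAt (fun d => if d ≤ a then f d else g d) f' (Ici a) a := by
    refine hg.hasDerivWithinAt.congr (fun d hd => ?_) (by simp [h])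
    rcases eq_or_lt_of_le (show a ≤ d from hd) with rfl | hlt
    · simp [h]
    · simp [not_le.2 hlt]
  simpa [Iic_union_Ici, hasDerivWithinAt_univ] using h1.union h2

theorem hasDerivAt_ite_le_min {f g f' g' : ℝ → ℝ} {a : ℝ} (hf : ∀ d, HasDerivAt f (f' d) d)
    (hg : ∀ d, HasDerivAt g (g' d) d) (h : f a = g a) (h' : f' a = g' a) (d : ℝ) :
    HasDerivAt (fun d => if d ≤ a then f d else g d) (if d ≤ a then f' d else g' d) d := by
  rcases lt_trichotomy d a with hd | rfl | hd
  · rw [if_pos hd.le]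
    refine (hf d).congr_of_eventuallyEq ?_
    filter_upwards [Iio_mem_nhds hd] with e he
    exact if_pos (le_of_lt he)
  · rw [if_pos le_rfl]
    exact hasDerivAt_ite_le (hf d) (h' ▸ hg d) h
  · rw [if_neg (not_le.2 hd)]
    refine (hg d).congr_of_eventuallyEq ?_
    filter_upwards [Ioi_mem_nhds hd] with e he
    exact if_neg (not_le.2 he)

theorem hasDerivAt_Hx {r : ℝ} (hr : 0 < r) (θ d : ℝ) :
    HasDerivAt (Hx r θ) (if d ≤ r * θ then cos (d / r) else cos θ) d := by
  have hθ : r * θ / r = θ := mul_div_cancel_left₀ θ hr.ne'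
  refine hasDerivAt_ite_le_min (f' := fun d => cos (d / r)) (g' := fun _ => cos θ)
    (fun d => ?_) (fun d => ?_) ?_ ?_ d
  · have := ((hasDerivAt_id d).div_const r).sin.const_mul r
    refine this.congr_deriv ?_
    simp only [id]
    field_simp
  · have := (((hasDerivAt_id d).sub_const (r * θ)).mul_const (cos θ)).add_const (r * sin θ)
    exact this.congr_deriv (one_mul _)
  · simp [hθ]
  · simp [hθ]

theorem hasDerivAt_Hy {r : ℝ} (hr : 0 < r) (θ d : ℝ) :
    HasDerivAt (Hy r θ) (if d ≤ r * θ then sin (d / r) else sin θ) d := by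
  have hθ : r * θ / r = θ := mul_div_cancel_left₀ θ hr.ne'
  refine hasDerivAt_ite_le_min (f' := fun d => sin (d / r)) (g' := fun _ => sin θ)
    (fun d => ?_) (fun d => ?_) ?_ ?_ d
  · have := (((hasDerivAt_id d).div_const r).cos.const_mul r).neg.add_const r
    refine this.congr_deriv ?_
    simp only [id]
    field_simp
  · have := ((((hasDerivAt_id d).sub_const (r * θ)).mul_const (sin θ)).sub_const
      (r * cos θ)).add_const r
    exact this.congr_deriv (one_mul _)
  · simp [hθ]
  · simp [hθ]

/-- The motion is differentiable with unit speed, so only the end-point condition has content. -/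
theorem pathSegment_iff {r θ D x y : ℝ} (hr : 0 < r) (hθ : 0 < θ) :
    PathSegment D (Hx r θ) (Hy r θ) (0, 0) (x, y) ↔ Hx r θ D = x ∧ Hy r θ D = y := by
  refine ⟨fun h => by simpa using h.finish, fun h => ?_⟩
  have hspeed : (fun a => √(deriv (Hx r θ) a ^ 2 + deriv (Hy r θ) a ^ 2)) = fun _ => 1 := by
    funext a
    rw [(hasDerivAt_Hx hr θ a).deriv, (hasDerivAt_Hy hr θ a).deriv]
    split_ifs <;> simp [cos_sq_add_sin_sq]
  have h0 : 0 ≤ r * θ := by positivity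
  exact
    { continuous_fst := fun d _ => (hasDerivAt_Hx hr θ d).continuousAt.continuousWithinAt
      continuous_snd := fun d _ => (hasDerivAt_Hy hr θ d).continuousAt.continuousWithinAt
      differentiable_fst := fun d _ => (hasDerivAt_Hx hr θ d).differentiableAt
      differentiable_snd := fun d _ => (hasDerivAt_Hy hr θ d).differentiableAt
      integrable_speed := fun d _ => by rw [hspeed]; exact intervalIntegrable_const
      arcLength := fun d _ => by rw [hspeed]; simp
      start := by simp [Hx, Hy, h0]
      finish := by rw [h.1, h.2] }

/-! ### Approach with a given bearing -/

/-- The cotangent of half the angle. -/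
def halfCot (θ : ℝ) : ℝ := sin θ / (1 - cos θ)

/-- Length of the straight part of the path that approaches `(x, y)` with bearing `θ`. -/
def S (x y θ : ℝ) : ℝ := y * halfCot θ - x

/-- Length of the path that approaches `(x, y)` with bearing `θ`. -/
def F (x y θ : ℝ) : ℝ := R x y θ * θ + S x y θ

theorem one_sub_cos_pos {θ : ℝ} (h0 : 0 < θ) (h1 : θ < 2 * π) : 0 < 1 - cos θ := by
  refine sub_pos.2 (lt_of_le_of_ne (cos_le_one θ) fun h => ?_)
  exact h0.ne' ((cos_eq_one_iff_of_lt_of_lt (by linarith) h1).1 h)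

theorem halfCot_sq {θ : ℝ} (h : 0 < 1 - cos θ) :
    halfCot θ ^ 2 = (1 + cos θ) / (1 - cos θ) := by
  rw [halfCot, div_pow, sin_sq, div_eq_div_iff (by positivity) h.ne']
  ring

/-- In terms of `c = halfCot θ`, `S` is affine and `R` quadratic; this turns the trigonometric
comparisons into polynomial ones. -/
theorem R_eq {θ : ℝ} (x y : ℝ) (h : 0 < 1 - cos θ) :
    R x y θ = x * halfCot θ - y * (halfCot θ ^ 2 - 1) / 2 := by
  rw [halfCot_sq h, halfCot, R]
  field_simp
  ring

theorem hasDerivAt_halfCot {θ : ℝ} (h : 0 < 1 - cos θ) :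
    HasDerivAt halfCot (-(1 / (1 - cos θ))) θ := by
  refine ((hasDerivAt_sin θ).div ((hasDerivAt_cos θ).const_sub 1) h.ne').congr_deriv ?_
  have := sin_sq_add_cos_sq θ
  field_simp
  linear_combination -this

theorem hasDerivAt_S {θ : ℝ} (x y : ℝ) (h : 0 < 1 - cos θ) :
    HasDerivAt (S x y) (-(y / (1 - cos θ))) θ := by
  refine (((hasDerivAt_halfCot h).const_mul y).sub_const x).congr_deriv ?_
  ring

theorem hasDerivAt_R {θ : ℝ} (x y : ℝ) (h : 0 < 1 - cos θ) :
    HasDerivAt (R x y) (S x y θ / (1 - cos θ)) θ := by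
  refine ((((hasDerivAt_sin θ).const_mul x).sub ((hasDerivAt_cos θ).const_mul y)).div
    ((hasDerivAt_cos θ).const_sub 1) h.ne').congr_deriv ?_
  have := sin_sq_add_cos_sq θ
  simp only [S, halfCot, Pi.sub_apply]
  field_simp
  linear_combination -x * this

theorem hasDerivAt_F {θ : ℝ} (x y : ℝ) (h : 0 < 1 - cos θ) :
    HasDerivAt (F x y) (S x y θ / (1 - cos θ) * (θ - sin θ)) θ := by
  refine (((hasDerivAt_R x y h).mul (hasDerivAt_id θ)).add (hasDerivAt_S x y h)).congr_deriv ?_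
  have := sin_sq_add_cos_sq θ
  simp only [S, halfCot, R, id]
  field_simp
  linear_combination y * this

theorem halfCot_strictAntiOn : StrictAntiOn halfCot (Ioo 0 (2 * π)) := by
  refine strictAntiOn_of_hasDerivWithinAt_neg (f' := fun θ => -(1 / (1 - cos θ)))
    (convex_Ioo _ _) (fun θ hθ => ?_) (fun θ hθ => ?_) (fun θ hθ => ?_)
  · exact (hasDerivAt_halfCot (one_sub_cos_pos hθ.1 hθ.2)).continuousAt.continuousWithinAt
  · rw [interior_Ioo] at hθ
    exact (hasDerivAt_halfCot (one_sub_cos_pos hθ.1 hθ.2)).hasDerivWithinAt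
  · rw [interior_Ioo] at hθ
    have := one_sub_cos_pos hθ.1 hθ.2
    simp only [neg_lt_zero]
    positivity

theorem S_nonneg_of_mem_Icc {x y a b θ : ℝ} (ha : 0 < a) (hb : b < 2 * π) (hSa : 0 ≤ S x y a)
    (hSb : 0 ≤ S x y b) (hθ : θ ∈ Icc a b) : 0 ≤ S x y θ := by
  have h1 := halfCot_strictAntiOn.antitoneOn ⟨ha, by linarith [hθ.1, hθ.2]⟩
    ⟨by linarith [hθ.1], by linarith [hθ.2]⟩ hθ.1
  have h2 := halfCot_strictAntiOn.antitoneOn ⟨by linarith [hθ.1], by linarith [hθ.2]⟩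
    ⟨by linarith [hθ.1, hθ.2], hb⟩ hθ.2
  unfold S at *
  rcases le_total 0 y with hy | hy <;> nlinarith

theorem F_le_F {x y a b : ℝ} (ha : 0 < a) (hb : b < 2 * π) (hab : a ≤ b) (hSa : 0 ≤ S x y a)
    (hSb : 0 ≤ S x y b) : F x y a ≤ F x y b := by
  have hcos : ∀ θ ∈ Icc a b, 0 < 1 - cos θ := fun θ hθ =>
    one_sub_cos_pos (by linarith [hθ.1]) (by linarith [hθ.2])
  refine monotoneOn_of_hasDerivWithinAt_nonneg
    (f' := fun θ => S x y θ / (1 - cos θ) * (θ - sin θ)) (convex_Icc a b) (fun θ hθ => ?_)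
    (fun θ hθ => ?_) (fun θ hθ => ?_) (left_mem_Icc.2 hab) (right_mem_Icc.2 hab) hab
  · exact (hasDerivAt_F x y (hcos θ hθ)).continuousAt.continuousWithinAt
  · exact (hasDerivAt_F x y (hcos θ (interior_subset hθ))).hasDerivWithinAt
  · have hθ' := interior_subset hθ
    exact mul_nonneg (div_nonneg (S_nonneg_of_mem_Icc ha hb hSa hSb hθ') (hcos θ hθ').le)
      (sub_nonneg.2 (sin_le (by linarith [hθ'.1])))

/-- `R b - R a = (halfCot a - halfCot b) * (S a + S b) / 2`. The last sum vanishes only at the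
origin, where `R` is zero; `hR` excludes this. -/
theorem R_lt_R {x y a b : ℝ} (ha : 0 < a) (hb : b < 2 * π) (hab : a < b) (hSa : 0 ≤ S x y a)
    (hSb : 0 ≤ S x y b) (hR : 0 < R x y a ∨ 0 < R x y b) : R x y a < R x y b := by
  have hc : halfCot b < halfCot a :=
    halfCot_strictAntiOn ⟨ha, by linarith⟩ ⟨by linarith, hb⟩ hab
  rw [R_eq x y (one_sub_cos_pos ha (by linarith)), R_eq x y (one_sub_cos_pos (by linarith) hb)]
    at *
  unfold S at *
  have key : 0 < (y * halfCot a - x) + (y * halfCot b - x) := by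
    refine lt_of_le_of_ne (by linarith) fun h => ?_
    have hy : y * (halfCot a - halfCot b) = 0 := by linarith
    have hy : y = 0 := (mul_eq_zero.1 hy).resolve_right (by linarith)
    have hx : x = 0 := by subst hy; linarith
    subst hx hy
    simp at hR
  nlinarith [mul_pos key (sub_pos.2 hc)]

theorem R_le_R {x y a b : ℝ} (ha : 0 < a) (hb : b < 2 * π) (hab : a ≤ b) (hSa : 0 ≤ S x y a)
    (hSb : 0 ≤ S x y b) (hR : 0 < R x y a ∨ 0 < R x y b) : R x y a ≤ R x y b := by
  rcases eq_or_lt_of_le hab with rfl | hlt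
  · exact le_rfl
  · exact (R_lt_R ha hb hlt hSa hSb hR).le

/-- A linear system in `(r, s)` with determinant `1 - cos θ`. -/
theorem eq_R_S_iff {x y r s θ : ℝ} (h : 0 < 1 - cos θ) :
    (x = r * sin θ + s * cos θ ∧ y = r * (1 - cos θ) + s * sin θ) ↔
      r = R x y θ ∧ s = S x y θ := by
  have hcs := sin_sq_add_cos_sq θ
  constructor
  · rintro ⟨rfl, rfl⟩
    constructor
    · rw [R, eq_div_iff h.ne']
      linear_combination (-r) * hcs
    · simp only [S, halfCot]
      field_simp
      linear_combination (-s) * hcs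
  · rintro ⟨rfl, rfl⟩
    simp only [S, halfCot, R]
    constructor
    · field_simp
      linear_combination (-x) * hcs
    · field_simp
      linear_combination (-y) * hcs

theorem L_eq_F {x y θ : ℝ} (h : 0 < 1 - cos θ) (hS : 0 ≤ S x y θ) :
    L x y θ (R x y θ) = F x y θ := by
  obtain ⟨hx, hy⟩ := (eq_R_S_iff (x := x) (y := y) h).2 ⟨rfl, rfl⟩
  have hx' : x - R x y θ * sin θ = S x y θ * cos θ := by linarith
  have hy' : y - R x y θ * (1 - cos θ) = S x y θ * sin θ := by linarith
  rw [L, F, hx', hy', EuclideanSpace.norm_eq, Fin.sum_univ_two]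
  simp only [Matrix.cons_val_zero, Matrix.cons_val_one, Real.norm_eq_abs, sq_abs]
  rw [show (S x y θ * cos θ) ^ 2 + (S x y θ * sin θ) ^ 2 = S x y θ ^ 2 by
    linear_combination S x y θ ^ 2 * sin_sq_add_cos_sq θ, sqrt_sq hS]

/-! ### The set of path lengths -/

/-- `(x, y)` is passed with bearing `τ` by the admissible path with final bearing `θc`. -/
structure Passes (rα rβ θα θβ x y τ θc : ℝ) : Prop where
  pos : 0 < τ
  le : τ ≤ θc
  lt_two_pi : θc < 2 * π
  le_bearing : θα ≤ θc
  bearing_le : θc ≤ θβ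
  le_radius : rα ≤ R x y τ
  radius_le : R x y τ ≤ rβ
  S_nonneg : 0 ≤ S x y τ
  final : τ = θc ∨ S x y τ = 0

theorem mem_pathLengths_iff {rα rβ θα θβ x y D : ℝ} (hr : 0 < rα) :
    D ∈ pathLengths rα rβ θα θβ x y ↔
      ∃ τ θc, Passes rα rβ θα θβ x y τ θc ∧ D = F x y τ := by
  constructor
  · rintro ⟨hD, r, ⟨hr1, hr2⟩, θ, ⟨hθ1, hθ2⟩, ⟨h0, h2π⟩, hpath⟩
    have hr0 : 0 < r := by linarith
    have hθ0 : 0 < θ := pos_of_mul_pos_right h0 hr0.le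
    have hθπ : θ < 2 * π := by
      rw [abs_of_pos hr0, mul_comm] at h2π
      exact lt_of_mul_lt_mul_right h2π hr0.le
    obtain ⟨hx, hy⟩ := (pathSegment_iff hr0 hθ0).1 hpath
    unfold Hx at hx
    unfold Hy at hy
    split_ifs at hx hy with hle
    -- The point is met on the arc: the bearing there is `D / r` and the straight length is zero.
    · have hτ : 0 < D / r := by positivity
      have hτθ : D / r ≤ θ := by rwa [div_le_iff₀ hr0, mul_comm]
      obtain ⟨hR, hS⟩ := (eq_R_S_iff (x := x) (y := y) (r := r) (s := 0)
        (one_sub_cos_pos hτ (by linarith))).1 ⟨by linarith, by linarith⟩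
      refine ⟨D / r, θ, ⟨hτ, hτθ, hθπ, hθ1, hθ2, hR ▸ hr1, hR ▸ hr2, hS.le, Or.inr hS.symm⟩, ?_⟩
      rw [F, ← hR, ← hS]
      field_simp
      ring
    · obtain ⟨hR, hS⟩ := (eq_R_S_iff (x := x) (y := y) (r := r) (s := D - r * θ)
        (one_sub_cos_pos hθ0 hθπ)).1 ⟨by linarith, by linarith⟩
      refine ⟨θ, θ, ⟨hθ0, le_rfl, hθπ, hθ1, hθ2, hR ▸ hr1, hR ▸ hr2, ?_, Or.inl rfl⟩, ?_⟩
      · rw [← hS]; linarith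
      · rw [F, ← hR, ← hS]; ring
  · rintro ⟨τ, θ, h, rfl⟩
    have hr0 : 0 < R x y τ := hr.trans_le h.le_radius
    have hτ := h.pos
    have hθ0 : 0 < θ := hτ.trans_le h.le
    obtain ⟨hx, hy⟩ := (eq_R_S_iff (x := x) (y := y)
      (one_sub_cos_pos hτ (h.le.trans_lt h.lt_two_pi))).2 ⟨rfl, rfl⟩
    refine ⟨add_pos_of_pos_of_nonneg (by positivity) h.S_nonneg, R x y τ,
      ⟨h.le_radius, h.radius_le⟩, θ, ⟨h.le_bearing, h.bearing_le⟩, ⟨by positivity, ?_⟩, ?_⟩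
    · rw [abs_of_pos hr0, mul_comm]
      exact mul_lt_mul_of_pos_right h.lt_two_pi hr0
    rw [pathSegment_iff hr0 hθ0]
    rcases eq_or_lt_of_le h.S_nonneg with hS | hS
    · have hF : F x y τ = R x y τ * τ := by rw [F, ← hS, add_zero]
      have hle : F x y τ ≤ R x y τ * θ := by rw [hF]; exact mul_le_mul_of_nonneg_left h.le hr0.le
      have hdiv : F x y τ / R x y τ = τ := by rw [hF, mul_div_cancel_left₀ _ hr0.ne']
      rw [← hS] at hx hy
      rw [Hx, Hy, if_pos hle, if_pos hle, hdiv]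
      exact ⟨by linarith, by linarith⟩
    · obtain rfl : τ = θ := h.final.resolve_right hS.ne'
      have hlt : ¬ F x y τ ≤ R x y τ * τ := by rw [F]; linarith
      have hsub : F x y τ - R x y τ * τ = S x y τ := by rw [F]; ring
      rw [Hx, Hy, if_neg hlt, if_neg hlt, hsub]
      exact ⟨by linarith, by linarith⟩

/-! ### The approach angle for a given radius -/

theorem halfCot_two_mul {t : ℝ} (h : sin t ≠ 0) : halfCot (2 * t) = cos t / sin t := by
  have hcs := sin_sq_add_cos_sq t
  rw [halfCot, sin_two_mul, cos_two_mul,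
    show 1 - (2 * cos t ^ 2 - 1) = 2 * sin t ^ 2 by linear_combination (-2) * hcs]
  field_simp

theorem halfCot_two_mul_arctan {w : ℝ} (h : w ≠ 0) : halfCot (2 * arctan w) = w⁻¹ := by
  have hs : sin (arctan w) ≠ 0 := by
    rw [sin_arctan]; positivity
  rw [halfCot_two_mul hs, ← inv_div, ← tan_eq_sin_div_cos, tan_arctan]

theorem halfCot_add_two_pi (θ : ℝ) : halfCot (θ + 2 * π) = halfCot θ := by
  simp [halfCot]

theorem halfCot_pi : halfCot π = 0 := by
  simp [halfCot]

/-- The approach angle is in range, and its half has cotangent `c` with `y * c - x` the length of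
the tangent. -/
theorem Θ_spec_aux {x y r : ℝ} (hr : 0 < r) (hdisc : 0 ≤ x ^ 2 - (2 * r - y) * y)
    (hx : y = 0 → x < 0) :
    0 < Θ x y r ∧ Θ x y r < 2 * π ∧
      y * halfCot (Θ x y r) - x = √(x ^ 2 - (2 * r - y) * y) ∧
      y * halfCot (Θ x y r) ^ 2 - 2 * x * halfCot (Θ x y r) + (2 * r - y) = 0 := by
  have hπ := pi_pos
  -- Here the quadratic for the half cotangent has roots `0` and `2 * x / y`; the sign of `x`
  -- selects the one with nonnegative tangent length.
  by_cases hq : 2 * r - y = 0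
  · have hy : y = 2 * r := by linarith
    rw [Θ, if_neg (not_not.2 hq)]
    simp only [hq, zero_mul, sub_zero, add_zero]
    split_ifs with h
    · have hw : 0 < y / (2 * x) := by rw [hy]; positivity
      have hy0 : y ≠ 0 := by rw [hy]; positivity
      rw [halfCot_two_mul_arctan hw.ne', sqrt_sq h.le]
      have := arctan_pos.2 hw
      have := arctan_lt_pi_div_two (y / (2 * x))
      refine ⟨by linarith, by linarith, ?_, ?_⟩ <;> field_simp <;> ring
    · rw [halfCot_pi, sqrt_sq_eq_abs, abs_of_nonpos (not_lt.1 h)]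
      refine ⟨hπ, by linarith, by ring, by ring⟩
  · rw [Θ, if_pos hq]
    set d := √(x ^ 2 - (2 * r - y) * y) with hd
    have hd2 : d ^ 2 = x ^ 2 - (2 * r - y) * y := sq_sqrt hdisc
    have hd0 : 0 ≤ d := sqrt_nonneg _
    set w := (x - d) / (2 * r - y) with hw
    -- Since `(x - d) * (x + d) = (2 * r - y) * y`, the inverse of `w` is the root `c` with `y * c =
    -- x + d`.
    have alg : w ≠ 0 → y * w⁻¹ - x = d ∧ y * w⁻¹ ^ 2 - 2 * x * w⁻¹ + (2 * r - y) = 0 := by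
      intro hw0
      have hxd : x - d ≠ 0 := fun h => hw0 (by rw [hw, h, zero_div])
      rw [hw, inv_div]
      constructor
      · field_simp
        linear_combination hd2
      · field_simp
        linear_combination (2 * r - y) * hd2
    have pos : 0 < w → P x y r = 0 → 0 < 2 * arctan w + P x y r ∧
        2 * arctan w + P x y r < 2 * π ∧ halfCot (2 * arctan w + P x y r) = w⁻¹ := by
      intro h hP
      have := arctan_pos.2 h
      have := arctan_lt_pi_div_two w
      rw [hP, add_zero]
      exact ⟨by linarith, by linarith, halfCot_two_mul_arctan h.ne'⟩
    have neg : w < 0 → P x y r = 2 * π → 0 < 2 * arctan w + P x y r ∧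
        2 * arctan w + P x y r < 2 * π ∧ halfCot (2 * arctan w + P x y r) = w⁻¹ := by
      intro h hP
      have := arctan_lt_zero.2 h
      have := neg_pi_div_two_lt_arctan w
      rw [hP, halfCot_add_two_pi]
      exact ⟨by linarith, by linarith, halfCot_two_mul_arctan h.ne⟩
    -- The phase must compensate the sign of `w` to bring the angle into `(0, 2π)`.
    suffices hcase : (0 < w ∧ P x y r = 0) ∨ (w < 0 ∧ P x y r = 2 * π) by
      rcases hcase with ⟨h1, h2⟩ | ⟨h1, h2⟩
      · obtain ⟨h3, h4, h5⟩ := pos h1 h2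
        rw [h5]
        exact ⟨h3, h4, alg h1.ne'⟩
      · obtain ⟨h3, h4, h5⟩ := neg h1 h2
        rw [h5]
        exact ⟨h3, h4, alg h1.ne⟩
    unfold P
    split_ifs with h1 h2
    · refine Or.inl ⟨?_, rfl⟩
      rcases h1 with ⟨hx0, hy0⟩ | ⟨hx0, hy0⟩
      · rcases lt_or_gt_of_ne hq with hq' | hq'
        · exact div_pos_of_neg_of_neg (by nlinarith) hq'
        · exact div_pos (by nlinarith [mul_pos hq' hy0]) hq'
      · exact div_pos_of_neg_of_neg (by nlinarith) (by linarith)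
    · refine Or.inr ⟨?_, rfl⟩
      rcases h2 with ⟨hx0, hy0⟩ | ⟨hx0, hy0⟩
      · exact div_neg_of_neg_of_pos (by nlinarith) (by linarith)
      · exact div_neg_of_neg_of_pos (by linarith) (by linarith)
    · exfalso
      simp only [not_or, not_and, not_lt] at h1 h2
      rcases lt_trichotomy y 0 with hy | hy | hy
      · rcases le_or_gt 0 x with h | h
        · linarith [h2.1 h]
        · linarith [h2.2 h]
      · linarith [h2.2 (hx hy)]
      · rcases lt_trichotomy x 0 with h | h | h
        · exact hq (by linarith [h2.2 h, h1.2 h.le])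
        · have hq' : 0 < 2 * r - y := lt_of_le_of_ne (by linarith [h1.2 h.le]) (Ne.symm hq)
          rw [h] at hdisc
          nlinarith [mul_pos hq' hy]
        · linarith [h1.1 h]

theorem Θ_spec {x y r τ : ℝ} (hr : 0 < r) (hτ0 : 0 < τ) (hτ : τ < 2 * π) (hS : 0 ≤ S x y τ)
    (hR : r ≤ R x y τ) :
    0 < Θ x y r ∧ Θ x y r ≤ τ ∧ R x y (Θ x y r) = r ∧ 0 ≤ S x y (Θ x y r) := by
  have hR' := hR
  rw [R_eq x y (one_sub_cos_pos hτ0 hτ)] at hR'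
  -- The discriminant equals `S ^ 2 + 2 * y * (R - r)`, which settles `y ≥ 0`.
  have hdisc : 0 ≤ x ^ 2 - (2 * r - y) * y := by
    rcases le_total 0 y with hy | hy
    · nlinarith [sq_nonneg (y * halfCot τ - x), mul_le_mul_of_nonneg_left hR' hy]
    · nlinarith [sq_nonneg x, sq_nonneg y]
  have hx : y = 0 → x < 0 := by
    rintro rfl
    refine lt_of_le_of_ne (by simpa [S] using hS) ?_
    rintro rfl
    simp at hR'
    linarith
  obtain ⟨h0, h1, h2, h3⟩ := Θ_spec_aux hr hdisc hx
  have hST : 0 ≤ S x y (Θ x y r) := by rw [S, h2]; exact sqrt_nonneg _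
  have hRT : R x y (Θ x y r) = r := by
    rw [R_eq x y (one_sub_cos_pos h0 h1)]
    linarith
  refine ⟨h0, ?_, hRT, hST⟩
  by_contra! hlt
  have := R_lt_R hτ0 h1 hlt hS hST (Or.inr (by rw [hRT]; exact hr))
  linarith

/-! ### The pure circular arc -/

/-- The chord makes half the turning angle with the initial tangent, so the half cotangent of `θm`
is `x / y`. -/
theorem θm_spec {x y : ℝ} (hy : 0 < y) :
    0 < θm x y ∧ θm x y < 2 * π ∧ S x y (θm x y) = 0 ∧ R x y (θm x y) = rm x y := by
  have hz : (⟨x, y⟩ : ℂ) ≠ 0 := fun h => hy.ne' (congrArg Complex.im h)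
  have harg0 : 0 < Complex.arg ⟨x, y⟩ := by
    refine lt_of_le_of_ne (Complex.arg_nonneg_iff.2 hy.le) fun h => ?_
    exact hy.ne' (Complex.arg_eq_zero_iff.1 h.symm).2
  have hargπ : Complex.arg ⟨x, y⟩ < π :=
    Complex.arg_lt_pi_iff.2 (Or.inr hy.ne')
  have h0 : 0 < θm x y := by rw [θm, atan2]; linarith
  have h1 : θm x y < 2 * π := by rw [θm, atan2]; linarith
  have hc : halfCot (θm x y) = x / y := by
    have hn : ‖(⟨x, y⟩ : ℂ)‖ ≠ 0 := norm_ne_zero_iff.2 hz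
    rw [θm, atan2, halfCot_two_mul (sin_pos_of_pos_of_lt_pi harg0 hargπ).ne',
      Complex.cos_arg hz, Complex.sin_arg, div_div_div_cancel_right₀ hn]
  refine ⟨h0, h1, ?_, ?_⟩
  · rw [S, hc]
    field_simp
    ring
  · rw [R_eq x y (one_sub_cos_pos h0 h1), hc, rm]
    field_simp
    ring

theorem θm_neg {x y : ℝ} (hy : y < 0) : θm x y < 0 := by
  have : Complex.arg ⟨x, y⟩ < 0 := Complex.arg_neg_iff.2 hy
  rw [θm, atan2]
  linarith

theorem θm_zero {x : ℝ} (hx : x < 0) : θm x 0 = 2 * π := by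
  have : Complex.arg ⟨x, 0⟩ = π := Complex.arg_eq_pi_iff.2 ⟨hx, rfl⟩
  rw [θm, atan2, this]

theorem y_pos_of_rm_pos {x y : ℝ} (h : 0 < rm x y) : 0 < y := by
  by_contra! hy
  exact h.not_ge (div_nonpos_of_nonneg_of_nonpos (by positivity) (by linarith))

theorem S_nonneg_iff_le_θm {x y τ : ℝ} (hy : 0 < y) (hτ0 : 0 < τ) (hτ : τ < 2 * π) :
    0 ≤ S x y τ ↔ τ ≤ θm x y := by
  obtain ⟨h0, h1, hS, -⟩ := θm_spec (x := x) hy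
  rw [← halfCot_strictAntiOn.le_iff_ge ⟨h0, h1⟩ ⟨hτ0, hτ⟩, ← hS, S, S, sub_le_sub_iff_right,
    mul_le_mul_iff_right₀ hy]

theorem eq_θm_of_S_eq_zero {x y τ : ℝ} (hy : 0 < y) (hτ0 : 0 < τ) (hτ : τ < 2 * π)
    (hSτ : S x y τ = 0) : τ = θm x y := by
  obtain ⟨h0, h1, hS, -⟩ := θm_spec (x := x) hy
  refine halfCot_strictAntiOn.injOn ⟨hτ0, hτ⟩ ⟨h0, h1⟩ (mul_left_cancel₀ hy.ne' ?_)
  unfold S at hS hSτ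
  linarith

/-- When `S = 0`, `R = y * (halfCot τ ^ 2 + 1) / 2`. -/
theorem y_pos_of_S_eq_zero {x y τ : ℝ} (hτ0 : 0 < τ) (hτ : τ < 2 * π) (hS : S x y τ = 0)
    (hR : 0 < R x y τ) : 0 < y := by
  rw [R_eq x y (one_sub_cos_pos hτ0 hτ)] at hR
  have hx : x = y * halfCot τ := by unfold S at hS; linarith
  rw [hx] at hR
  by_contra! hy
  nlinarith [sq_nonneg (halfCot τ)]

theorem S_nonneg_of_le {x y a b : ℝ} (hy : y ≤ 0) (ha : 0 < a) (hab : a ≤ b) (hb : b < 2 * π)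
    (hS : 0 ≤ S x y a) : 0 ≤ S x y b := by
  have := halfCot_strictAntiOn.antitoneOn ⟨ha, by linarith⟩ ⟨by linarith, hb⟩ hab
  unfold S at *
  nlinarith

/-! ### The minimum length -/

section

variable {rα rβ θα θβ x y τ θc : ℝ}

theorem Passes.lt (h : Passes rα rβ θα θβ x y τ θc) : τ < 2 * π :=
  h.le.trans_lt h.lt_two_pi

theorem Passes.Θ_spec (hr : 0 < rα) (h : Passes rα rβ θα θβ x y τ θc) :
    0 < Θ x y rα ∧ Θ x y rα ≤ τ ∧ R x y (Θ x y rα) = rα ∧ 0 ≤ S x y (Θ x y rα) :=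
  TurnToBearing.Θ_spec hr h.pos h.lt h.S_nonneg h.le_radius

/-- If the minimum bearing precedes the pure arc, every admissible path approaches the point with
at least the minimum bearing. -/
theorem Passes.le_of_lt_θm (hr : 0 < rα) (h : Passes rα rβ θα θβ x y τ θc)
    (hθ : 0 < y → θα < θm x y) : θα ≤ τ := by
  rcases h.final with h1 | h1
  · exact h1 ▸ h.le_bearing
  · have hy := y_pos_of_S_eq_zero h.pos h.lt h1 (hr.trans_le h.le_radius)
    rw [eq_θm_of_S_eq_zero hy h.pos h.lt h1]
    exact (hθ hy).le

/-- Arriving at the final bearing means `τ ≥ θα ≥ θm`, while `S ≥ 0` means `τ ≤ θm`. -/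
theorem Passes.eq_θm (h : Passes rα rβ θα θβ x y τ θc) (hy : 0 < y) (hθ : θm x y ≤ θα) :
    τ = θm x y := by
  rcases h.final with h1 | h1
  · exact le_antisymm ((S_nonneg_iff_le_θm hy h.pos h.lt).1 h.S_nonneg)
      (hθ.trans (h1 ▸ h.le_bearing))
  · exact eq_θm_of_S_eq_zero hy h.pos h.lt h1

theorem isLeast_of_passes (hr : 0 < rα) (h : Passes rα rβ θα θβ x y τ θc)
    (hmin : ∀ τ' θc', Passes rα rβ θα θβ x y τ' θc' → τ ≤ τ') :
    IsLeast (pathLengths rα rβ θα θβ x y) (L x y τ (R x y τ)) := by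
  rw [L_eq_F (one_sub_cos_pos h.pos h.lt) h.S_nonneg]
  refine ⟨(mem_pathLengths_iff hr).2 ⟨τ, θc, h, rfl⟩, fun D hD => ?_⟩
  obtain ⟨τ', θc', h', rfl⟩ := (mem_pathLengths_iff hr).1 hD
  exact F_le_F h.pos h'.lt (hmin _ _ h') h.S_nonneg h'.S_nonneg

theorem MinRadiusCase.isLeast (hr : 0 < rα) (h : Passes rα rβ θα θβ x y τ θc)
    (hc : MinRadiusCase rα θα θβ x y) :
    IsLeast (pathLengths rα rβ θα θβ x y) (L x y (Θ x y rα) rα) := by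
  obtain ⟨h0, h1, hR, hS⟩ := h.Θ_spec hr
  have hT : Passes rα rβ θα θβ x y (Θ x y rα) (Θ x y rα) :=
    ⟨h0, le_rfl, h1.trans_lt h.lt, hc.1, hc.2, hR.ge, hR.le.trans (h.le_radius.trans h.radius_le),
      hS, Or.inl rfl⟩
  have := isLeast_of_passes hr hT fun τ' θc' h' => (h'.Θ_spec hr).2.1
  rwa [hR] at this

theorem MinBearingCase.isLeast (hr : 0 < rα) (h : Passes rα rβ θα θβ x y τ θc)
    (hc : MinBearingCase rα θα x y) :
    IsLeast (pathLengths rα rβ θα θβ x y) (L x y θα (R x y θα)) := by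
  obtain ⟨-, hpos, hlt⟩ := hc
  obtain ⟨h0, h1, hR, hS⟩ := h.Θ_spec hr
  have hθα : 0 < θα := h0.trans hlt
  have hπ : θα < 2 * π := h.le_bearing.trans_lt h.lt_two_pi
  have hm : 0 < y → θα < θm x y := fun hy => by
    rcases hpos with h | h
    · exact h.2.2
    · linarith [h.1]
  have hSα : 0 ≤ S x y θα := by
    rcases le_or_gt y 0 with hy | hy
    · exact S_nonneg_of_le hy h0 hlt.le hπ hS
    · exact (S_nonneg_iff_le_θm hy hθα hπ).2 (hm hy).le
  have hτ := h.le_of_lt_θm hr hm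
  -- Monotonicity of `R` along `Θ x y rα < θα ≤ τ` places the induced radius in `[rα, rβ]`.
  have hRα : rα ≤ R x y θα := by
    have := R_le_R h0 hπ hlt.le hS hSα (Or.inl (by rwa [hR]))
    rwa [hR] at this
  have hRβ := R_le_R hθα h.lt hτ hSα h.S_nonneg (Or.inl (hr.trans_le hRα))
  have hT : Passes rα rβ θα θβ x y θα θα :=
    ⟨hθα, le_rfl, hπ, le_rfl, h.le_bearing.trans h.bearing_le, hRα, hRβ.trans h.radius_le, hSα,
      Or.inl rfl⟩
  exact isLeast_of_passes hr hT fun τ' θc' h' => h'.le_of_lt_θm hr hm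

theorem ArcCase.isLeast (hr : 0 < rα) (h : Passes rα rβ θα θβ x y τ θc)
    (hc : ArcCase rα rβ θα x y) :
    IsLeast (pathLengths rα rβ θα θβ x y) (L x y (θm x y) (rm x y)) := by
  obtain ⟨hrα, hrβ, hle⟩ := hc
  have hy := y_pos_of_rm_pos (hr.trans_le hrα)
  obtain ⟨hm0, hm1, hmS, hmR⟩ := θm_spec (x := x) hy
  have hmin : ∀ τ' θc', Passes rα rβ θα θβ x y τ' θc' → θm x y ≤ τ' := fun τ' θc' h' => by
    rcases le_max_iff.1 hle with hle | hle
    · exact (h'.eq_θm hy hle).ge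
    · exact hle.trans (h'.Θ_spec hr).2.1
  -- The given path's final bearing is reused: the point is met on the arc, so `θm` may lie below
  -- `θα`.
  have hT : Passes rα rβ θα θβ x y (θm x y) θc :=
    ⟨hm0, (hmin _ _ h).trans h.le, h.lt_two_pi, h.le_bearing, h.bearing_le, by rwa [hmR],
      by rwa [hmR], hmS.ge, Or.inr hmS⟩
  have := isLeast_of_passes hr hT hmin
  rwa [hmR] at this

theorem Passes.cases (hr : 0 < rα) (h : Passes rα rβ θα θβ x y τ θc) :
    MinRadiusCase rα θα θβ x y ∨ MinBearingCase rα θα x y ∨ ArcCase rα rβ θα x y := by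
  obtain ⟨h0, h1, hR, hS⟩ := h.Θ_spec hr
  have hπ : θα < 2 * π := h.le_bearing.trans_lt h.lt_two_pi
  rcases le_or_gt θα (Θ x y rα) with hle | hlt
  · exact Or.inl ⟨hle, h1.trans (h.le.trans h.bearing_le)⟩
  refine Or.inr ?_
  rcases lt_trichotomy y 0 with hy | hy | hy
  · refine Or.inl ⟨?_, Or.inr ⟨hy, θm_neg hy⟩, hlt⟩
    nlinarith [sq_nonneg x, sq_nonneg y, mul_neg_of_pos_of_neg hr hy]
  · subst hy
    have hx : x < 0 := by
      refine lt_of_le_of_ne (by simpa [S] using hS) ?_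
      rintro rfl
      rw [R] at hR
      simp at hR
      linarith
    refine Or.inl ⟨?_, Or.inl ⟨le_rfl, Or.inr rfl, by rwa [θm_zero hx]⟩, hlt⟩
    nlinarith
  · obtain ⟨hm0, hm1, hmS, hmR⟩ := θm_spec (x := x) hy
    rcases lt_or_ge θα (θm x y) with hm | hm
    · have hrm : rα < rm x y := by
        have := R_lt_R h0 hm1 (hlt.trans hm) hS hmS.ge (Or.inl (by rwa [hR]))
        rwa [hR, hmR] at this
      refine Or.inl ⟨?_, Or.inl ⟨hy.le, Or.inl hrm.le, hm⟩, hlt⟩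
      rw [rm, lt_div_iff₀ (by positivity)] at hrm
      linarith
    · have hτ := h.eq_θm hy hm
      have h2 := h.le_radius
      have h3 := h.radius_le
      rw [hτ, hmR] at h2 h3
      exact Or.inr ⟨h2, h3, hm.trans (le_max_left _ _)⟩

end

end TurnToBearing

end

theorem mainTheorem1 (rα rβ θα θβ x y : ℝ) (hr : 0 < rα) (hθ : 0 < θα)
    (hreach : TurnToBearing.Reachable rα rβ θα θβ x y) :
    IsLeast (TurnToBearing.pathLengths rα rβ θα θβ x y)
      (TurnToBearing.dMin rα rβ θα θβ x y) ∧
    (TurnToBearing.MinRadiusCase rα θα θβ x y ∨ TurnToBearing.MinBearingCase rα θα x y ∨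
      TurnToBearing.ArcCase rα rβ θα x y) ∧
    (TurnToBearing.MinRadiusCase rα θα θβ x y →
      TurnToBearing.dMin rα rβ θα θβ x y =
        TurnToBearing.L x y (TurnToBearing.Θ x y rα) rα) ∧
    (TurnToBearing.MinBearingCase rα θα x y →
      TurnToBearing.dMin rα rβ θα θβ x y =
        TurnToBearing.L x y θα (TurnToBearing.R x y θα)) ∧
    (TurnToBearing.ArcCase rα rβ θα x y →
      TurnToBearing.dMin rα rβ θα θβ x y =
        TurnToBearing.L x y (TurnToBearing.θm x y) (TurnToBearing.rm x y)) := by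
  obtain ⟨D, hD⟩ := hreach
  obtain ⟨τ, θc, h, -⟩ := (TurnToBearing.mem_pathLengths_iff hr).1 hD
  have hcases := h.cases hr
  have hleast : IsLeast (TurnToBearing.pathLengths rα rβ θα θβ x y) (TurnToBearing.dMin rα rβ θα θβ x y) := by
    unfold TurnToBearing.dMin
    split_ifs with h1 h2 h3
    · exact h1.isLeast hr h
    · exact h2.isLeast hr h
    · exact h3.isLeast hr h
    · tauto
  -- Overlapping pieces agree because a least element is unique.
  exact ⟨hleast, hcases, fun h1 => hleast.unique (h1.isLeast hr h),
    fun h2 => hleast.unique (h2.isLeast hr h), fun h3 => hleast.unique (h3.isLeast hr h)⟩
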